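/- Let $\mathcal P$ be a (nonempty) filtered poset, i.e. a poset admitting a strictly order-preserving map $\mathcal P\to\mathbb N$. For $p\in\mathcal P$ let the degree $d(p)$ be the maximum of the lengths $\ell$ of chains $p_0<p_1<\dots<p_\ell=p$ in $\mathcal P$ ending at $p$. Assume that $\mathcal P$ has finite length, i.e. that $\operatorname{length}(\mathcal P)=\max\{d(p)\mid p\in\mathcal P\}$, the maximum of the lengths of all chains of $\mathcal P$, is finite. Let $R$ be a commutative ring with unit and let $F\colon\mathcal P^{\mathrm{op}}\to R\text{-Mod}$ be a functor. For a poset $\mathcal Q$ and a functor $G\colon\mathcal Q^{\mathrm{op}}\to R\text{-Mod}$, denote by $H^k(\mathcal Q;G)$ the $k$-th right derived functor of $\lim\colon\operatorname{Fun}(\mathcal Q^{\mathrm{op}},R\text{-Mod})\to R\text{-Mod}$ applied to $G$, and write $\mathcal P_{<p}=\{q\in\mathcal P\mid q<p\}$ and $H^k(\mathcal P_{<p};F)=H^k(\mathcal P_{<p};F|_{\mathcal P_{<p}})$. Let $m,n\in\mathbb N$ (where $0\in\mathbb N$) with $m\le\operatorname{length}(\mathcal P)$. Suppose that $H^k(\mathcal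 P_{<p};F)=0$ for every $k\ge n$ and every $p\in\mathcal P$ with $d(p)\le m$. Then $H^k(\mathcal P;F)=0$ for every $k>n+\operatorname{length}(\mathcal P)-m$. -/

import Mathlib

open CategoryTheory CategoryTheory.Limits

universe w v

/-- A poset is filtered if it admits a strictly order-preserving map to the natural numbers. -/
def IsFilteredPoset (P : Type w) [PartialOrder P] : Prop :=
  ∃ d : P → ℕ, StrictMono d

/-- Functor categories into a category with products and enough injectives have enough
injectives. -/
instance functorCategory_enoughInjectives {C D : Type*} [Category* C] [Category* D]
    [EnoughInjectives D] [HasPullbacks D] [HasProductsOfShape C D]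
    [∀ a b : C, HasProductsOfShape (a ⟶ b) D] : EnoughInjectives (C ⥤ D) where
  presentation F := by
    let E : C → (C ⥤ D) := fun c => (evaluationRightAdjoint D c).obj (Injective.under (F.obj c))
    have hE : ∀ c, Injective (E c) := fun c =>
      Injective.injective_of_adjoint (evaluationAdjunctionLeft D c) _
    let η : ∀ c, F ⟶ E c := fun c =>
      (evaluationAdjunctionLeft D c).homEquiv F _ (Injective.ι (F.obj c))
    refine ⟨⟨∏ᶜ E, ⟨fun g f _ => ?_⟩, Pi.lift η, ⟨fun g h hgh => ?_⟩⟩⟩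
    · refine ⟨Pi.lift fun c => Injective.factorThru (g ≫ Pi.π E c) f, ?_⟩
      ext1 c
      simp
    · ext c : 2
      have h1 : g ≫ η c = h ≫ η c := by
        simpa using congrArg (fun t => t ≫ Pi.π E c) hgh
      have h2 := congrArg ((evaluationAdjunctionLeft D c).homEquiv _ _).symm h1
      simp only [η, Adjunction.homEquiv_naturality_left_symm, Equiv.symm_apply_apply] at h2
      exact (cancel_mono (Injective.ι (F.obj c))).1 h2

/-- The limit functor of a preadditive category is additive. -/
instance lim_additive {C D : Type*} [Category* C] [Category* D] [Preadditive D]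
    [HasLimitsOfShape C D] : (lim : (C ⥤ D) ⥤ D).Additive where
  map_add := by
    intro X Y f g
    apply limit.hom_ext
    intro j
    simp [Preadditive.add_comp, Preadditive.comp_add]

/-- The restriction of a presheaf of `R`-modules on `P` to the elements strictly below `p`. -/
abbrev restrictBelow {P : Type w} [PartialOrder P] {R : Type v} [CommRing R]
    (F : Pᵒᵖ ⥤ ModuleCat.{max w v} R) (p : P) : (Set.Iio p)ᵒᵖ ⥤ ModuleCat.{max w v} R :=
  (Subtype.mono_coe (· ∈ Set.Iio p)).functor.op ⋙ F

/-- The higher limit `H^k(P; F)`: the `k`-th right derived functor of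
`lim : Fun(Pᵒᵖ, R-Mod) ⥤ R-Mod`, applied to `F`. -/
noncomputable def higherLimit {P : Type w} [PartialOrder P] {R : Type v} [CommRing R]
    (F : Pᵒᵖ ⥤ ModuleCat.{max w v} R) (k : ℕ) : ModuleCat.{max w v} R :=
  ((lim : (Pᵒᵖ ⥤ ModuleCat.{max w v} R) ⥤ ModuleCat.{max w v} R).rightDerived k).obj F

/-! Higher limits are computed by the sections of an injective resolution `J` of `F`; restricting
`J` to `P_{<p}` gives an injective resolution again, so all the posets involved share `J`. The core
is `exactOn_of_exactOn_Iio`: for a lower set `S`, if sections of `J` over `P_{<p}` are exact in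
degree `k` for all `p ∈ S`, then sections over `S` are exact in degree `k + 1`. A primitive of a
cocycle is built by well-founded recursion on `p`; a local primitive at `p` differs from the one
already built on `P_{<p}` by a degree `k` cocycle, which is a coboundary, and injectivity extends
its primitive to `p`. Each unit of height thus costs one degree: vanishing from `n` on at height at
most `m` becomes vanishing from `n + j` on at height at most `m + j`. Taking `j = length - m`, a
final step with `S = P` costs one more degree, whence the strict inequality. -/

section Restriction

variable {P : Type w} [PartialOrder P] {R : Type v} [CommRing R]

/-- The inclusion of the elements strictly below `p`, as a functor of opposite categories. -/
abbrev belowInclusion (p : P) : (Set.Iio p)ᵒᵖ ⥤ Pᵒᵖ :=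
  (Subtype.mono_coe (· ∈ Set.Iio p)).functor.op

instance full_subtypeMono (p : P) : (Subtype.mono_coe (· ∈ Set.Iio p)).functor.Full where
  map_surjective {_ _} f := ⟨homOfLE (leOfHom f), rfl⟩

lemma isEmpty_costructuredArrow_belowInclusion (p : P) (q : Pᵒᵖ) (hq : ¬ q.unop < p) :
    IsEmpty (CostructuredArrow (belowInclusion p) q) :=
  ⟨fun a => hq (lt_of_le_of_lt (leOfHom a.hom.unop) a.left.unop.2)⟩

lemma isZero_lan_belowInclusion (p : P) (A : (Set.Iio p)ᵒᵖ ⥤ ModuleCat.{max w v} R)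
    (q : Pᵒᵖ) (hq : ¬ q.unop < p) : IsZero (((belowInclusion p).lan.obj A).obj q) := by
  have := isEmpty_costructuredArrow_belowInclusion p q hq
  have h := (belowInclusion p).isPointwiseLeftKanExtensionLeftKanExtensionUnit A q
  rw [IsZero.iff_id_eq_zero]
  apply h.hom_ext
  intro a
  exact this.elim a

/-- Since `P_{<p}` is a lower set, left Kan extension is extension by zero. Its right adjoint,
restriction, therefore preserves injectives. -/
instance lan_belowInclusion_preservesMonomorphisms (p : P) :
    ((belowInclusion p).lan :
      ((Set.Iio p)ᵒᵖ ⥤ ModuleCat.{max w v} R) ⥤ _).PreservesMonomorphisms where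
  preserves {A B} f hf := by
    rw [NatTrans.mono_iff_mono_app]
    intro q
    by_cases hq : q.unop < p
    · let q' : (Set.Iio p)ᵒᵖ := Opposite.op ⟨q.unop, hq⟩
      let a : A.obj q' ⟶ ((belowInclusion p).lan.obj A).obj q :=
        ((belowInclusion p).lanUnit.app A).app q'
      let b : B.obj q' ⟶ ((belowInclusion p).lan.obj B).obj q :=
        ((belowInclusion p).lanUnit.app B).app q'
      have ha : IsIso a :=
        inferInstanceAs (IsIso (((belowInclusion p).lanUnit.app A).app q'))
      have hb : IsIso b :=
        inferInstanceAs (IsIso (((belowInclusion p).lanUnit.app B).app q'))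
      have h : f.app q' ≫ b = a ≫ ((belowInclusion p).lan.map f).app q :=
        NatTrans.congr_app ((belowInclusion p).lanUnit.naturality f) q'
      rw [← IsIso.inv_comp_eq] at h
      rw [← h]
      infer_instance
    · exact ⟨fun g h _ => (isZero_lan_belowInclusion p A q hq).eq_of_tgt g h⟩

instance injective_restrictBelow (I : Pᵒᵖ ⥤ ModuleCat.{max w v} R) [Injective I] (p : P) :
    Injective (restrictBelow I p) :=
  Injective.injective_of_adjoint ((belowInclusion p).lanAdjunction _) I

/-- The restriction of an injective resolution to the elements strictly below `p`. -/
noncomputable def restrictBelowResolution {F : Pᵒᵖ ⥤ ModuleCat.{max w v} R}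
    (J : InjectiveResolution F) (p : P) : InjectiveResolution (restrictBelow F p) :=
  let W := (Functor.whiskeringLeft _ _ (ModuleCat.{max w v} R)).obj (belowInclusion p)
  { cocomplex := (W.mapHomologicalComplex _).obj J.cocomplex
    injective := fun n => injective_restrictBelow (J.cocomplex.X n) p
    ι := (HomologicalComplex.singleMapHomologicalComplex W (ComplexShape.up ℕ) 0).inv.app F ≫
      (W.mapHomologicalComplex _).map J.ι
    quasiIso := by infer_instance }

end Restriction

/-! ### Higher limits as cohomology of global sections -/

section Sections

variable {P : Type w} [PartialOrder P] {R : Type v} [CommRing R]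

/-- The restriction map of a presheaf on a poset. -/
def res (G : Pᵒᵖ ⥤ ModuleCat.{max w v} R) {q r : P} (h : r ≤ q) :
    G.obj (.op q) →ₗ[R] G.obj (.op r) := (G.map (homOfLE h).op).hom

lemma res_naturality {G H : Pᵒᵖ ⥤ ModuleCat.{max w v} R} (f : G ⟶ H) {q r : P} (h : r ≤ q)
    (x : G.obj (.op q)) : res H h ((f.app _).hom x) = (f.app _).hom (res G h x) :=
  (ConcreteCategory.congr_hom (f.naturality (homOfLE h).op) x).symm

lemma res_res (G : Pᵒᵖ ⥤ ModuleCat.{max w v} R) {q r s : P} (h : r ≤ q) (h' : s ≤ r)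
    (x : G.obj (.op q)) : res G h' (res G h x) = res G (h'.trans h) x := by
  have := ConcreteCategory.congr_hom (G.map_comp (homOfLE h).op (homOfLE h').op) x
  exact this.symm

lemma res_refl (G : Pᵒᵖ ⥤ ModuleCat.{max w v} R) {q : P} (h : q ≤ q)
    (x : G.obj (.op q)) : res G h x = x :=
  ConcreteCategory.congr_hom (G.map_id (.op q)) x

/-- A family of elements is a section of the presheaf `G` over `S` if it is compatible with
restriction maps out of elements of `S`. -/
def IsSectionOn (G : Pᵒᵖ ⥤ ModuleCat.{max w v} R) (S : Set P)
    (x : ∀ q : P, G.obj (.op q)) : Prop :=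
  ∀ q ∈ S, ∀ r (h : r ≤ q), res G h (x q) = x r

/-- Every section over `S` killed by `g` comes from a section over `S`. -/
def ExactOn {A B C : Pᵒᵖ ⥤ ModuleCat.{max w v} R} (f : A ⟶ B) (g : B ⟶ C) (S : Set P) : Prop :=
  ∀ x, IsSectionOn B S x → (∀ q ∈ S, (g.app (.op q)).hom (x q) = 0) →
    ∃ y, IsSectionOn A S y ∧ ∀ q ∈ S, (f.app (.op q)).hom (y q) = x q

lemma exists_lim_eq_of_isSectionOn (G : Pᵒᵖ ⥤ ModuleCat.{max w v} R)
    {x : ∀ q : P, G.obj (.op q)} (hx : IsSectionOn G Set.univ x) :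
    ∃ s : (limit G : ModuleCat.{max w v} R), ∀ q : P, (limit.π G (.op q)).hom s = x q := by
  let s : (G ⋙ forget (ModuleCat.{max w v} R)).sections :=
    ⟨fun q => x q.unop, fun f => hx _ trivial _ (leOfHom f.unop)⟩
  let h := isLimitOfPreserves (forget (ModuleCat.{max w v} R)) (limit.isLimit G)
  refine ⟨(Types.isLimitEquivSections h).symm s, fun q => ?_⟩
  exact Types.isLimitEquivSections_symm_apply h s (.op q)

lemma isSectionOn_lim (G : Pᵒᵖ ⥤ ModuleCat.{max w v} R) (s : (limit G : ModuleCat.{max w v} R)) :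
    IsSectionOn G Set.univ fun q => (limit.π G (.op q)).hom s := fun _ _ _ h =>
  ConcreteCategory.congr_hom (limit.w G (homOfLE h).op) s

lemma lim_range_iff_exactOn {A B C : Pᵒᵖ ⥤ ModuleCat.{max w v} R} (f : A ⟶ B) (g : B ⟶ C) :
    (∀ x, (lim.map g).hom x = 0 → ∃ y, (lim.map f).hom y = x) ↔ ExactOn f g Set.univ := by
  have nat : ∀ {X Y : Pᵒᵖ ⥤ ModuleCat.{max w v} R} (u : X ⟶ Y) (s : (limit X : ModuleCat.{max w v} R)) (q : P),
      (limit.π Y (.op q)).hom ((lim.map u).hom s) =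
        (u.app (.op q)).hom ((limit.π X (.op q)).hom s) := fun u s q =>
    ConcreteCategory.congr_hom (limMap_π u (.op q)) s
  constructor
  · intro H x hx hgx
    obtain ⟨s, hs⟩ := exists_lim_eq_of_isSectionOn B hx
    obtain ⟨y, rfl⟩ := H s (Concrete.limit_ext _ _ _ fun q =>
      (nat g s q.unop).trans (by rw [hs, hgx _ trivial]; exact (map_zero _).symm))
    exact ⟨_, isSectionOn_lim A y, fun q _ => by rw [← nat, hs]⟩
  · intro H s hs
    obtain ⟨y, hy, hfy⟩ := H _ (isSectionOn_lim B s) fun q _ => by rw [← nat, hs, map_zero]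
    obtain ⟨t, ht⟩ := exists_lim_eq_of_isSectionOn A hy
    exact ⟨t, Concrete.limit_ext _ _ _ fun q => (nat f t q.unop).trans (by
      rw [ht, hfy _ trivial])⟩

/-- For `k = 0` the convention gives `i = 0` and a zero differential `d 0 0`, so exactness then says
that `d 0 1` is injective on sections. -/
lemma isZero_higherLimit_iff {F : Pᵒᵖ ⥤ ModuleCat.{max w v} R} (J : InjectiveResolution F)
    (i k : ℕ) (hi : (ComplexShape.up ℕ).prev k = i) :
    IsZero (higherLimit F k) ↔
      ExactOn (J.cocomplex.d i k) (J.cocomplex.d k (k + 1)) Set.univ := by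
  rw [← lim_range_iff_exactOn]
  refine (J.isoRightDerivedObj lim k).isZero_iff.trans ?_
  refine (HomologicalComplex.exactAt_iff_isZero_homology _ _).symm.trans ?_
  rw [HomologicalComplex.exactAt_iff' _ i k (k + 1) hi (by simp)]
  exact ShortComplex.moduleCat_exact_iff _

end Sections

/-! ### Passage from presheaves on `P_{<p}` to sections over `P_{<p}` -/

section Below

variable {P : Type w} [PartialOrder P] {R : Type v} [CommRing R]

open Classical in
lemma exactOn_Iio_of_whiskerLeft {A B C : Pᵒᵖ ⥤ ModuleCat.{max w v} R} (f : A ⟶ B) (g : B ⟶ C)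
    (p : P) (H : ExactOn (Functor.whiskerLeft (belowInclusion p) f)
      (Functor.whiskerLeft (belowInclusion p) g) Set.univ) :
    ExactOn f g (Set.Iio p) := by
  intro x hx hgx
  obtain ⟨y, hy, hfy⟩ := H (fun q => x q.1) (fun q _ r h => hx q.1 q.2 r.1 h)
    (fun q _ => hgx q.1 q.2)
  let z : ∀ q : P, A.obj (.op q) := fun q => if h : q < p then y ⟨q, h⟩ else 0
  have hz : ∀ q (h : q < p), z q = y ⟨q, h⟩ := fun q h => dif_pos h
  refine ⟨z, fun q hq r h => ?_, fun q hq => ?_⟩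
  · rw [hz q hq, hz r (lt_of_le_of_lt h hq)]
    exact hy ⟨q, hq⟩ trivial ⟨r, lt_of_le_of_lt h hq⟩ h
  · rw [hz q hq]
    exact hfy ⟨q, hq⟩ trivial

lemma exactOn_Iio_of_isZero_higherLimit {F : Pᵒᵖ ⥤ ModuleCat.{max w v} R}
    (J : InjectiveResolution F) (p : P) (i k : ℕ) (hi : (ComplexShape.up ℕ).prev k = i)
    (h : IsZero (higherLimit (restrictBelow F p) k)) :
    ExactOn (J.cocomplex.d i k) (J.cocomplex.d k (k + 1)) (Set.Iio p) :=
  exactOn_Iio_of_whiskerLeft _ _ p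
    ((isZero_higherLimit_iff (restrictBelowResolution J p) i k hi).1 h)

end Below

/-! ### Extension of sections of injectives -/

section Flasque

variable {P : Type w} [PartialOrder P] {R : Type v} [CommRing R]

/-- The presheaf `q ↦ ∏_{r ≤ q} G r` of discontinuous sections of `G`. -/
def discontinuousSections (G : Pᵒᵖ ⥤ ModuleCat.{max w v} R) : Pᵒᵖ ⥤ ModuleCat.{max w v} R where
  obj q := ModuleCat.of R (∀ r : Set.Iic q.unop, G.obj (.op r.1))
  map f := ModuleCat.ofHom
    { toFun := fun s r => s ⟨r.1, le_trans r.2 (leOfHom f.unop)⟩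
      map_add' := fun _ _ => rfl
      map_smul' := fun _ _ => rfl }
  map_id _ := rfl
  map_comp _ _ := rfl

/-- The canonical map to the presheaf of discontinuous sections. -/
def toDiscontinuousSections (G : Pᵒᵖ ⥤ ModuleCat.{max w v} R) : G ⟶ discontinuousSections G where
  app q := ModuleCat.ofHom (LinearMap.pi fun r => res G r.2)
  naturality q q' f := by
    ext x
    funext r
    exact res_res G (leOfHom f.unop) r.2 x

instance mono_toDiscontinuousSections (G : Pᵒᵖ ⥤ ModuleCat.{max w v} R) :
    Mono (toDiscontinuousSections G) := by
  rw [NatTrans.mono_iff_mono_app]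
  intro q
  rw [ModuleCat.mono_iff_injective]
  intro x y h
  have h' := congrFun h ⟨q.unop, le_refl q.unop⟩
  exact (res_refl G (le_refl q.unop) x).symm.trans (h'.trans (res_refl G (le_refl q.unop) y))

open Classical in
/-- Sections of an injective presheaf over the elements strictly below `p` extend to `p`. -/
lemma exists_res_eq_of_injective (I : Pᵒᵖ ⥤ ModuleCat.{max w v} R) [Injective I] (p : P)
    {x : ∀ q : P, I.obj (.op q)} (hx : IsSectionOn I (Set.Iio p) x) :
    ∃ z : I.obj (.op p), ∀ q (h : q < p), res I h.le z = x q := by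
  let D := discontinuousSections I
  let ι := toDiscontinuousSections I
  -- Injectivity makes `I` a retract of `D`, where sections extend by arbitrary values.
  let π : D ⟶ I := Injective.factorThru (𝟙 I) ι
  let s : D.obj (.op p) := fun r => if r.1 < p then x r.1 else 0
  refine ⟨(π.app (.op p)).hom s, fun q h => ?_⟩
  rw [res_naturality]
  have hs : res D h.le s = (ι.app (.op q)).hom (x q) := by
    funext r
    have hr : r.1 < p := lt_of_le_of_lt r.2 h
    exact (if_pos hr).trans (hx q h r.1 r.2).symm
  rw [hs]
  have hι : ι ≫ π = 𝟙 I := Injective.comp_factorThru _ _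
  exact ConcreteCategory.congr_hom (NatTrans.congr_app hι (.op q)) (x q)

end Flasque

/-! ### The degree shift -/

section Step

variable {P : Type w} [PartialOrder P] {R : Type v} [CommRing R]

open Classical in
/-- An exact sequence of presheaves `A ⟶ B ⟶ C ⟶ D` with `A` injective which is exact at `B` on
sections over each `P_{<p}`, is exact at `C` on sections over every lower set. -/
lemma exactOn_of_exactOn_Iio [WellFoundedLT P] {A B C D : Pᵒᵖ ⥤ ModuleCat.{max w v} R}
    [Injective A] (f : A ⟶ B) (g : B ⟶ C) (h : C ⟶ D) (hfg : f ≫ g = 0) (hgh : g ≫ h = 0)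
    (hC : (ShortComplex.mk g h hgh).Exact) {S : Set P} (hS : IsLowerSet S)
    (H : ∀ p ∈ S, ExactOn f g (Set.Iio p)) : ExactOn g h S := by
  intro x hx hhx
  have hloc : ∀ p (c : C.obj (.op p)), (h.app (.op p)).hom c = 0 →
      ∃ b, (g.app (.op p)).hom b = c := fun p =>
    (ShortComplex.moduleCat_exact_iff _).1
      (hC.map ((evaluation Pᵒᵖ (ModuleCat.{max w v} R)).obj (.op p)))
  have hfg' : ∀ p (a : A.obj (.op p)), (g.app (.op p)).hom ((f.app (.op p)).hom a) = 0 :=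
    fun p a => ConcreteCategory.congr_hom (NatTrans.congr_app hfg (.op p)) a
  let Good (p : P) (y : ∀ q, q < p → B.obj (.op q)) (b : B.obj (.op p)) : Prop :=
    (∀ q (hq : q < p), res B hq.le b = y q hq) ∧ (g.app (.op p)).hom b = x p
  let y : ∀ p : P, B.obj (.op p) := WellFoundedLT.fix fun p y =>
    if hy : ∃ b, Good p y b then hy.choose else 0
  have hy : ∀ p, y p = if hy : ∃ b, Good p (fun q _ => y q) b then hy.choose else 0 :=
    fun p => WellFoundedLT.fix_eq _ p
  have good : ∀ p, p ∈ S → Good p (fun q _ => y q) (y p) := by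
    intro p
    induction p using WellFoundedLT.induction with
    | ind p ih =>
      intro hp
      suffices hb : ∃ b, Good p (fun q _ => y q) b by
        rw [hy p, dif_pos hb]
        exact hb.choose_spec
      obtain ⟨z, hz⟩ := hloc p (x p) (hhx p hp)
      have hSp : ∀ q, q < p → q ∈ S := fun q hq => hS hq.le hp
      have ysec : ∀ q, q < p → ∀ r (hr : r ≤ q), res B hr (y q) = y r := by
        intro q hq r hr
        obtain rfl | hr' := eq_or_lt_of_le hr
        · exact res_refl B hr _
        · exact (ih q hq (hSp q hq)).1 r hr'
      -- The discrepancy on `P_{<p}` between the primitive built so far and the local one `z`; `g`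
      -- kills it.
      let t : ∀ q : P, B.obj (.op q) := fun q => if hq : q < p then y q - res B hq.le z else 0
      have ht : ∀ q (hq : q < p), t q = y q - res B hq.le z := fun q hq => dif_pos hq
      obtain ⟨a, ha, hfa⟩ := H p hp t
        (fun q hq r hr => by
          rw [ht q hq, ht r (lt_of_le_of_lt hr hq), map_sub, ysec q hq r hr, res_res])
        (fun q hq => by
          rw [ht q hq, map_sub, (ih q hq (hSp q hq)).2, ← res_naturality, hz,
            hx p hp q (le_of_lt hq), sub_self])
      obtain ⟨a', ha'⟩ := exists_res_eq_of_injective A p ha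
      -- Adding `f a'` cancels the discrepancy and leaves the image under `g` unchanged, since `f ≫
      -- g = 0`.
      refine ⟨z + (f.app (.op p)).hom a', fun q hq => ?_, ?_⟩
      · rw [map_add, res_naturality, ha' q hq, hfa q hq, ht q hq, add_sub_cancel]
      · rw [map_add, hz, hfg', add_zero]
  refine ⟨y, fun q hq r hr => ?_, fun q hq => (good q hq).2⟩
  obtain rfl | hr' := eq_or_lt_of_le hr
  · exact res_refl B hr _
  · exact (good q hq).1 r hr'

end Step

lemma IsFilteredPoset.wellFoundedLT {P : Type w} [PartialOrder P] (hP : IsFilteredPoset P) :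
    WellFoundedLT P := by
  obtain ⟨d, hd⟩ := hP
  exact hd.wellFoundedLT

theorem mainTheorem7 {P : Type w} [PartialOrder P] (hP : IsFilteredPoset P)
    {R : Type v} [CommRing R] (F : Pᵒᵖ ⥤ ModuleCat.{max w v} R)
    (length : ℕ) (hlength : Order.krullDim P = length)
    (m n : ℕ) (hm : m ≤ length)
    (hF : ∀ p : P, Order.height p ≤ m → ∀ k : ℕ, n ≤ k →
      IsZero (higherLimit (restrictBelow F p) k)) :
    ∀ k : ℕ, n + (length - m) < k → IsZero (higherLimit F k) := by
  have := hP.wellFoundedLT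
  let J := injectiveResolution F
  have step : ∀ (k : ℕ) {S : Set P}, IsLowerSet S → (∀ p ∈ S,
      ExactOn (J.cocomplex.d ((ComplexShape.up ℕ).prev k) k) (J.cocomplex.d k (k + 1))
        (Set.Iio p)) →
      ExactOn (J.cocomplex.d k (k + 1)) (J.cocomplex.d (k + 1) (k + 2)) S :=
    fun k _ hS H => exactOn_of_exactOn_Iio _ _ _ (J.cocomplex.d_comp_d _ _ _)
      (J.cocomplex.d_comp_d _ _ _) (J.exact_succ k) hS H
  have below : ∀ (j : ℕ) (p : P), Order.height p ≤ (m + j : ℕ) → ∀ k, n + j ≤ k →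
      ExactOn (J.cocomplex.d ((ComplexShape.up ℕ).prev k) k) (J.cocomplex.d k (k + 1))
        (Set.Iio p) := by
    intro j
    induction j with
    | zero => exact fun p hp k hk =>
        exactOn_Iio_of_isZero_higherLimit J p _ k rfl (hF p hp k hk)
    | succ j ih =>
      intro p hp k hk
      obtain ⟨k, rfl⟩ : ∃ l, k = l + 1 := ⟨k - 1, by omega⟩
      rw [show (ComplexShape.up ℕ).prev (k + 1) = k by simp]
      refine step k (isLowerSet_Iio p) fun q hq => ih q ?_ k (by omega)
      -- Height is strictly monotone only where it is finite.
      have hfin : Order.height q < ⊤ := lt_of_le_of_lt (Order.height_mono (le_of_lt hq))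
        (lt_of_le_of_lt hp (ENat.natCast_lt_top _))
      have hlt : Order.height q < (m + j + 1 : ℕ) :=
        lt_of_lt_of_le (Order.height_strictMono hq hfin) hp
      exact Order.le_of_lt_add_one (by exact_mod_cast hlt)
  intro k hk
  obtain ⟨k, rfl⟩ : ∃ l, k = l + 1 := ⟨k - 1, by omega⟩
  rw [isZero_higherLimit_iff J k (k + 1) (by simp)]
  refine step k isLowerSet_univ fun p _ => below (length - m) p ?_ k (by omega)
  rw [Nat.add_sub_cancel' hm]
  exact_mod_cast (Order.height_le_krullDim p).trans_eq hlength
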